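/- Let $k\in\{0,1,2,\dots\}\cup\{\infty\}$. For an open set $V\subseteq\mathbb R$ let $C^k(V)$ be the ring of real-valued functions on $V$ that are $k$ times continuously differentiable (continuous if $k=0$, having derivatives of all orders if $k=\infty$), and let $R=C^k(\mathbb R)$. Consider the following rings of quotients of $R$: - the classical ring of quotients $Q_{\mathrm{cl}}(R)$, that is, the localization of $R$ at the set of all its non-zero-divisors; - the complete (Utumi–Lambek) ring of quotients $Q(R)=\varinjlim_{D}\operatorname{Hom}_R(D,R)$, the direct limit along restriction over the ideals $D$ of $R$ with zero annihilator, ordered by reverse inclusion, with multiplication induced by composition of homomorphisms, and with $R\to Q(R)$ sending $r$ to the class of multiplication by $r$; - the maximal flat epimorphic extension $Q_{\mathrm{tot}}(R)$. Here a flat epimorphic extension of $R$ is an injective ring homomorphism $R\to B$ that is an epimorphism in the category of all (unital, not necessarily commutative) rings and makes $B$ a flat $R$-module; and $Q_{\mathrm{tot}}(R)$ is a flat epimorphic extension of $R$ such that for every flat epimorphic extension $R\to B$ there is exactly one ring homomorphism $B\to Q_{\mathrm{tot}}(R)$ compatible with the maps from $R$, and this homomorphism is injective. Then $Q_{\mathrm{cl}}(R)$,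 $Q(R)$ and $Q_{\mathrm{tot}}(R)$ coincide: $Q_{\mathrm{cl}}(R)\cong Q(R)$ as $R$-algebras, and $R\to Q_{\mathrm{cl}}(R)$ has the property defining $Q_{\mathrm{tot}}(R)$. This common ring is von Neumann regular (for every $a$ there is $x$ with $axa=a$) and self-injective (injective as a module over itself). Moreover it is isomorphic, as an $R$-algebra, to the direct limit $\varinjlim_{V} C^k(V)$ over the dense open subsets $V$ of $\mathbb R$, ordered by reverse inclusion, along the restriction maps. -/

import Mathlib

universe u

namespace RingsOfQuotients

/-! ### Ring-theoretic notions -/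

/-- A ring is von Neumann regular if every `a` has an `x` with `a * x * a = a`. -/
def IsVonNeumannRegular (A : Type u) [Ring A] : Prop :=
  ∀ a : A, ∃ x : A, a * x * a = a

/-- A ring is self-injective if it is injective as a module over itself. -/
def IsSelfInjective (A : Type u) [Ring A] : Prop :=
  Module.Injective A A

/-- Epimorphisms in the category of all (associative, unital, not necessarily commutative) rings. -/
def IsRingEpi {A B : Type u} [Ring A] [Ring B] (e : A →+* B) : Prop :=
  ∀ (C : Type u) [Ring C] (f g : B →+* C), f.comp e = g.comp e → f = g

/-- `e : A → B` is flat if `B` is flat over `A` for the module structure `a • b = e a * b`. -/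
def IsFlatHom {A B : Type u} [CommRing A] [Ring B] (e : A →+* B) : Prop :=
  letI : Module A B := Module.compHom B e
  Module.Flat A B

/-- A flat epimorphic extension of `A`: an injective flat epimorphism of rings `A → B`. -/
structure IsFlatEpiExtension {A B : Type u} [CommRing A] [Ring B] (e : A →+* B) : Prop where
  injective : Function.Injective e
  flat : IsFlatHom e
  epi : IsRingEpi e

/-- `e : A → Q` is the maximal flat epimorphic extension `Q_tot(A)`: it is a flat epimorphic
extension, and every flat epimorphic extension `A → B` embeds in it over `A`, in a unique way.
This determines `Q` up to a unique isomorphism over `A`. -/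
structure IsMaximalFlatEpiExtension {A Q : Type u} [CommRing A] [Ring Q] (e : A →+* Q) :
    Prop where
  isFlatEpiExtension : IsFlatEpiExtension e
  existsUnique_embedding : ∀ (B : Type u) [Ring B] (b : A →+* B), IsFlatEpiExtension b →
    ∃ j : B →+* Q, Function.Injective j ∧ j.comp b = e ∧
      ∀ j' : B →+* Q, j'.comp b = e → j' = j

/-! ### The complete ring of quotients -/

section Complete

variable (A : Type u) [CommRing A]

/-- An ideal is dense if its annihilator is zero. -/
def IsDenseIdeal {A : Type u} [CommRing A] (D : Ideal A) : Prop :=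
  ∀ r : A, (∀ d ∈ D, r * d = 0) → r = 0

theorem IsDenseIdeal.mul {A : Type u} [CommRing A] {D E : Ideal A}
    (hD : IsDenseIdeal D) (hE : IsDenseIdeal E) : IsDenseIdeal (D * E) := by
  intro r hr
  refine hD r fun d hd ↦ hE _ fun e he ↦ ?_
  rw [mul_assoc]
  exact hr _ (Ideal.mul_mem_mul hd he)

/-- The dense ideals of `A`, ordered by reverse inclusion. -/
abbrev DenseIdeals : Type u := {D : Ideal A // IsDenseIdeal D}ᵒᵈ

namespace DenseIdeals

variable {A}

/-- The underlying ideal. -/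
abbrev ideal (D : DenseIdeals A) : Ideal A := (OrderDual.ofDual D).1

theorem dense (D : DenseIdeals A) : IsDenseIdeal D.ideal := (OrderDual.ofDual D).2

theorem ideal_le {D E : DenseIdeals A} (h : D ≤ E) : E.ideal ≤ D.ideal := h

/-- Products of dense ideals are dense. -/
def prod (D E : DenseIdeals A) : DenseIdeals A :=
  OrderDual.toDual ⟨D.ideal * E.ideal, D.dense.mul E.dense⟩

theorem le_prod_left (D E : DenseIdeals A) : D ≤ D.prod E :=
  (Ideal.mul_le_left : D.ideal * E.ideal ≤ D.ideal)

theorem le_prod_right (D E : DenseIdeals A) : E ≤ D.prod E :=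
  (Ideal.mul_le_right : D.ideal * E.ideal ≤ E.ideal)

instance : Nonempty (DenseIdeals A) :=
  ⟨OrderDual.toDual ⟨⊤, fun r hr ↦ by simpa using hr 1 trivial⟩⟩

instance : IsDirectedOrder (DenseIdeals A) :=
  ⟨fun D E ↦ ⟨D.prod E, D.le_prod_left E, D.le_prod_right E⟩⟩

/-- The module `Hom_A(D, A)`. -/
abbrev Hom (D : DenseIdeals A) : Type u := D.ideal →ₗ[A] A

/-- Restriction `Hom_A(D, A) → Hom_A(E, A)` for `E ⊆ D`. -/
def res (D E : DenseIdeals A) (h : D ≤ E) : D.Hom →ₗ[A] E.Hom :=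
  LinearMap.lcomp A A (Submodule.inclusion (ideal_le h))

@[simp]
theorem res_apply {D E : DenseIdeals A} (h : D ≤ E) (φ : D.Hom) (x : E.ideal) :
    res D E h φ x = φ ⟨x.1, ideal_le h x.2⟩ := rfl

instance : DirectedSystem (fun D : DenseIdeals A ↦ D.Hom) (res · · ·) where
  map_self _ _ := rfl
  map_map _ _ _ _ _ _ := rfl

theorem hom_mem (D : DenseIdeals A) (ψ : D.Hom) (x : D.ideal)
    (hx : (x : A) ∈ D.ideal * D.ideal) : ψ x ∈ D.ideal := by
  obtain ⟨x, hxD⟩ := x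
  change x ∈ _ at hx
  induction hx using Submodule.mul_induction_on' with
  | mem_mul_mem d hd e he =>
    have h := ψ.map_smul d ⟨e, he⟩
    have h' : ψ ⟨d * e, hxD⟩ = d * ψ ⟨e, he⟩ := h
    rw [h']
    exact D.ideal.mul_mem_right _ hd
  | add y hy z hz ihy ihz =>
    have h := ψ.map_add ⟨y, Ideal.mul_le_left hy⟩ ⟨z, Ideal.mul_le_left hz⟩
    have h' : ψ ⟨y + z, hxD⟩ = ψ ⟨y, Ideal.mul_le_left hy⟩ + ψ ⟨z, Ideal.mul_le_left hz⟩ := h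
    rw [h']
    exact D.ideal.add_mem (ihy _) (ihz _)

/-- The composite `x ↦ φ (ψ x)` of two elements of `Hom_A(D, A)`, which is defined on `D²`
because `ψ` maps `D²` into `D`. -/
def comp (D : DenseIdeals A) (φ ψ : D.Hom) : (D.prod D).Hom where
  toFun x := φ ⟨ψ ⟨x.1, Ideal.mul_le_left x.2⟩, D.hom_mem ψ _ x.2⟩
  map_add' x y := by
    rw [← map_add φ]
    congr 1
    exact Subtype.ext (ψ.map_add ⟨x.1, Ideal.mul_le_left x.2⟩ ⟨y.1, Ideal.mul_le_left y.2⟩)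
  map_smul' r x := by
    rw [← map_smul φ]
    congr 1
    exact Subtype.ext (ψ.map_smul r ⟨x.1, Ideal.mul_le_left x.2⟩)

theorem comp_apply (D : DenseIdeals A) (φ ψ : D.Hom) (x : (D.prod D).ideal) :
    D.comp φ ψ x = φ ⟨ψ ⟨x.1, Ideal.mul_le_left x.2⟩, D.hom_mem ψ _ x.2⟩ := rfl

theorem comp_comm (D : DenseIdeals A) (φ ψ : D.Hom) : D.comp φ ψ = D.comp ψ φ := by
  ext ⟨x, hx⟩
  have key : ∀ (φ ψ : D.Hom) (d : A) (hd : d ∈ D.ideal) (e : A) (he : e ∈ D.ideal),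
      D.comp φ ψ ⟨d * e, Ideal.mul_mem_mul hd he⟩ = φ ⟨d, hd⟩ * ψ ⟨e, he⟩ := by
    intro φ ψ d hd e he
    have h1 : ψ ⟨d * e, D.ideal.mul_mem_right e hd⟩ = d * ψ ⟨e, he⟩ := ψ.map_smul d ⟨e, he⟩
    have h2 : φ ⟨ψ ⟨e, he⟩ * d, D.ideal.mul_mem_left _ hd⟩ = ψ ⟨e, he⟩ * φ ⟨d, hd⟩ :=
      φ.map_smul (ψ ⟨e, he⟩) ⟨d, hd⟩
    rw [comp_apply, mul_comm (φ _), ← h2]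
    congr 1
    exact Subtype.ext (h1.trans (mul_comm _ _))
  have key' : ∀ (φ ψ : D.Hom) (d : A) (hd : d ∈ D.ideal) (e : A) (he : e ∈ D.ideal),
      D.comp φ ψ ⟨d * e, Ideal.mul_mem_mul hd he⟩ = φ ⟨e, he⟩ * ψ ⟨d, hd⟩ := by
    intro φ ψ d hd e he
    rw [← key φ ψ e he d hd]
    congr 1
    exact Subtype.ext (mul_comm _ _)
  induction hx using Submodule.mul_induction_on' with
  | mem_mul_mem d hd e he => rw [key φ ψ d hd e he, key' ψ φ d hd e he, mul_comm]
  | add y hy z hz ihy ihz =>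
    have h := congrArg₂ (· + ·) ihy ihz
    simp only [← map_add] at h
    exact h

end DenseIdeals

open DenseIdeals in
/-- The complete (Utumi-Lambek) ring of quotients of `A`: the direct limit of the modules
`Hom_A(D, A)` over the dense ideals `D` of `A`. Its multiplication is induced by composition. -/
def CompleteRingOfQuotients : Type u :=
  DirectLimit (fun D : DenseIdeals A ↦ D.Hom) res

namespace CompleteRingOfQuotients

variable {A}

/-- The class of `φ : D → A` in the complete ring of quotients. -/
def mk (D : DenseIdeals A) (φ : D.Hom) : CompleteRingOfQuotients A := ⟦⟨D, φ⟩⟧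

noncomputable instance : AddCommGroup (CompleteRingOfQuotients A) :=
  inferInstanceAs (AddCommGroup (DirectLimit (fun D : DenseIdeals A ↦ D.Hom) DenseIdeals.res))

noncomputable instance : Mul (CompleteRingOfQuotients A) where
  mul := DirectLimit.lift₂ DenseIdeals.res DenseIdeals.res
    (fun D φ ψ ↦ mk (D.prod D) (D.comp φ ψ))
    (fun _ E h _ _ ↦ Quotient.sound
      ⟨E.prod E, Ideal.mul_mono (DenseIdeals.ideal_le h) (DenseIdeals.ideal_le h), le_rfl, rfl⟩)

theorem mk_add (D : DenseIdeals A) (φ ψ : D.Hom) : mk D φ + mk D ψ = mk D (φ + ψ) :=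
  DirectLimit.add_def ..

theorem mk_mul (D : DenseIdeals A) (φ ψ : D.Hom) :
    mk D φ * mk D ψ = mk (D.prod D) (D.comp φ ψ) :=
  DirectLimit.lift₂_def ..

theorem mk_res {D E : DenseIdeals A} (h : D ≤ E) (φ : D.Hom) :
    mk E (DenseIdeals.res D E h φ) = mk D φ :=
  (DirectLimit.eq_of_le ⟨D, φ⟩ E h).symm

/-- The class of the multiplication `x ↦ a * x` on `A`; this is the image of `a : A`. -/
def ofElem (a : A) : CompleteRingOfQuotients A :=
  mk (OrderDual.toDual ⟨⊤, fun r hr ↦ by simpa using hr 1 trivial⟩)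
    (LinearMap.lsmul A A a ∘ₗ Submodule.subtype _)

theorem ofElem_eq (a : A) (D : DenseIdeals A) :
    ofElem a = mk D (LinearMap.lsmul A A a ∘ₗ Submodule.subtype _) :=
  (mk_res (E := D) (D := OrderDual.toDual ⟨⊤, _⟩) (le_top : D.ideal ≤ ⊤) _).symm

theorem induction₃ {C : CompleteRingOfQuotients A → CompleteRingOfQuotients A →
    CompleteRingOfQuotients A → Prop}
    (h : ∀ (D : DenseIdeals A) (φ ψ χ : D.Hom), C (mk D φ) (mk D ψ) (mk D χ)) (x y z) : C x y z :=
  DirectLimit.induction₃ DenseIdeals.res h x y z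

protected theorem mul_comm (x y : CompleteRingOfQuotients A) : x * y = y * x := by
  refine induction₃ (C := fun x y _ ↦ x * y = y * x) (fun D φ ψ _ ↦ ?_) x y x
  rw [mk_mul, mk_mul, D.comp_comm]

protected theorem one_mul (x : CompleteRingOfQuotients A) : ofElem 1 * x = x := by
  refine induction₃ (C := fun x _ _ ↦ ofElem 1 * x = x) (fun D φ _ _ ↦ ?_) x x x
  rw [ofElem_eq 1 D, mk_mul, ← mk_res (D.le_prod_left D) φ]
  congr 1
  ext x
  simp [DenseIdeals.comp_apply]

protected theorem mul_add (x y z : CompleteRingOfQuotients A) :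
    x * (y + z) = x * y + x * z := by
  refine induction₃ (C := fun x y z ↦ x * (y + z) = x * y + x * z) (fun D φ ψ χ ↦ ?_) x y z
  rw [mk_add, mk_mul, mk_mul, mk_mul, mk_add]
  congr 1
  ext x
  simp only [LinearMap.add_apply, DenseIdeals.comp_apply]
  rw [← map_add φ]
  rfl

protected theorem mul_assoc (x y z : CompleteRingOfQuotients A) :
    x * y * z = x * (y * z) := by
  refine induction₃ (C := fun x y z ↦ x * y * z = x * (y * z)) (fun D φ ψ χ ↦ ?_) x y z
  have h := D.le_prod_left D
  rw [mk_mul, mk_mul, ← mk_res h χ, ← mk_res h φ, mk_mul, mk_mul]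
  rfl

noncomputable instance : CommRing (CompleteRingOfQuotients A) where
  __ := (inferInstance : AddCommGroup (CompleteRingOfQuotients A))
  one := ofElem 1
  mul_comm := CompleteRingOfQuotients.mul_comm
  one_mul := CompleteRingOfQuotients.one_mul
  mul_one x := (CompleteRingOfQuotients.mul_comm _ _).trans (CompleteRingOfQuotients.one_mul x)
  left_distrib := CompleteRingOfQuotients.mul_add
  right_distrib x y z := by
    rw [CompleteRingOfQuotients.mul_comm, CompleteRingOfQuotients.mul_add,
      CompleteRingOfQuotients.mul_comm z, CompleteRingOfQuotients.mul_comm z]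
  mul_assoc := CompleteRingOfQuotients.mul_assoc
  zero_mul x := by
    have h := CompleteRingOfQuotients.mul_add x 0 0
    rw [add_zero, left_eq_add] at h
    rw [CompleteRingOfQuotients.mul_comm, h]
  mul_zero x := by
    have h := CompleteRingOfQuotients.mul_add x 0 0
    rwa [add_zero, left_eq_add] at h

theorem ofElem_add (a b : A) : ofElem (a + b) = ofElem a + ofElem b := by
  refine .trans ?_ (mk_add ..).symm
  simp only [ofElem, map_add, LinearMap.add_comp]

theorem ofElem_mul (a b : A) : ofElem (a * b) = ofElem a * ofElem b := by
  refine .trans ?_ (mk_mul ..).symm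
  rw [ofElem_eq]
  congr 1
  ext x
  simp [DenseIdeals.comp_apply, mul_assoc]

theorem ofElem_zero : ofElem (0 : A) = 0 := by
  have h := ofElem_add (0 : A) 0
  rwa [add_zero, left_eq_add] at h

/-- `A → Q(A)`, sending `a` to the class of the multiplication by `a`. -/
noncomputable instance : Algebra A (CompleteRingOfQuotients A) :=
  RingHom.toAlgebra
    { toFun := ofElem
      map_one' := rfl
      map_mul' := ofElem_mul
      map_zero' := ofElem_zero
      map_add' := ofElem_add }

end CompleteRingOfQuotients

end Complete

/-! ### Rings of `C^k` functions -/

/-- The ring `C^k(ℝ)`, for `k ∈ ℕ ∪ {∞}`. -/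
def Ck (k : ℕ∞) : Subring (ℝ → ℝ) where
  carrier := {f | ContDiff ℝ k f}
  mul_mem' {f g} (hf : ContDiff ℝ k f) (hg : ContDiff ℝ k g) := hf.mul hg
  one_mem' := (contDiff_const : ContDiff ℝ k fun _ : ℝ ↦ (1 : ℝ))
  add_mem' {f g} (hf : ContDiff ℝ k f) (hg : ContDiff ℝ k g) := hf.add hg
  zero_mem' := (contDiff_const : ContDiff ℝ k fun _ : ℝ ↦ (0 : ℝ))
  neg_mem' {f} (hf : ContDiff ℝ k f) := hf.neg

theorem Ck.contDiff {k : ℕ∞} (f : Ck k) : ContDiff ℝ k f.1 := f.2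

/-- The ring `C^k(V)` for `V` open in `ℝ`: functions `V → ℝ` that are `C^k` on `V`. (Off `V` the
values of the function `F` that represents `f` do not matter.) -/
def CkOn (k : ℕ∞) (V : TopologicalSpace.Opens ℝ) : Subring (V → ℝ) where
  carrier := {f | ∃ F : ℝ → ℝ, ContDiffOn ℝ k F V ∧ ∀ x : V, F x = f x}
  mul_mem' := by
    rintro f g ⟨F, hF, hFf⟩ ⟨G, hG, hGg⟩
    exact ⟨F * G, hF.mul hG, fun x ↦ by simp [hFf, hGg]⟩
  one_mem' := ⟨1, contDiffOn_const, fun _ ↦ rfl⟩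
  add_mem' := by
    rintro f g ⟨F, hF, hFf⟩ ⟨G, hG, hGg⟩
    exact ⟨F + G, hF.add hG, fun x ↦ by simp [hFf, hGg]⟩
  zero_mem' := ⟨0, contDiffOn_const, fun _ ↦ rfl⟩
  neg_mem' := by
    rintro f ⟨F, hF, hFf⟩
    exact ⟨-F, hF.neg, fun x ↦ by simp [hFf]⟩

/-- `C^k(V)` is an algebra over `C^k(ℝ)` by restriction. -/
instance (k : ℕ∞) (V : TopologicalSpace.Opens ℝ) : Algebra (Ck k) (CkOn k V) :=
  RingHom.toAlgebra
    { toFun := fun f ↦ ⟨fun x ↦ f.1 x, f.1, (Ck.contDiff f).contDiffOn, fun _ ↦ rfl⟩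
      map_one' := rfl
      map_mul' := fun _ _ ↦ rfl
      map_zero' := rfl
      map_add' := fun _ _ ↦ rfl }

/-- The dense open subsets of `ℝ`, ordered by reverse inclusion. -/
abbrev DenseOpens : Type := {V : TopologicalSpace.Opens ℝ // Dense (V : Set ℝ)}ᵒᵈ

namespace DenseOpens

/-- The underlying open set. -/
abbrev opens (V : DenseOpens) : TopologicalSpace.Opens ℝ := (OrderDual.ofDual V).1

theorem opens_le {V W : DenseOpens} (h : V ≤ W) : W.opens ≤ V.opens := h

instance : Nonempty DenseOpens := ⟨OrderDual.toDual ⟨⊤, dense_univ⟩⟩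

instance : IsDirectedOrder DenseOpens :=
  ⟨fun V W ↦ ⟨OrderDual.toDual ⟨V.opens ⊓ W.opens,
      (OrderDual.ofDual V).2.inter_of_isOpen_left (OrderDual.ofDual W).2 V.opens.isOpen⟩,
    (inf_le_left : V.opens ⊓ W.opens ≤ V.opens), (inf_le_right : V.opens ⊓ W.opens ≤ W.opens)⟩⟩

/-- Restriction `C^k(V) → C^k(W)` for dense open `W ⊆ V`. -/
def res (k : ℕ∞) (V W : DenseOpens) (h : V ≤ W) : CkOn k V.opens →ₐ[Ck k] CkOn k W.opens where
  toFun f := ⟨fun x ↦ f.1 ⟨x.1, opens_le h x.2⟩, by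
    obtain ⟨F, hF, hFf⟩ := f.2
    exact ⟨F, hF.mono (opens_le h), fun x ↦ hFf ⟨x.1, opens_le h x.2⟩⟩⟩
  map_one' := rfl
  map_mul' _ _ := rfl
  map_zero' := rfl
  map_add' _ _ := rfl
  commutes' _ := rfl

instance (k : ℕ∞) : DirectedSystem (fun V : DenseOpens ↦ CkOn k V.opens) (res k · · ·) where
  map_self _ _ := rfl
  map_map _ _ _ _ _ _ := rfl

end DenseOpens

/-- The direct limit of the `C^k(ℝ)`-algebras `C^k(V)` over the dense open sets `V ⊆ ℝ`,
along the restriction maps. -/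
abbrev DenseOpensLimit (k : ℕ∞) : Type :=
  DirectLimit (fun V : DenseOpens ↦ CkOn k V.opens) (DenseOpens.res k)

end RingsOfQuotients

open RingsOfQuotients

/-! Everything follows from one property of `A = C^k(ℝ)`, `HomsAreFractions`: each homomorphism from
a dense ideal to `A` is multiplication by some `a / s` with `s` a non-zero-divisor.

For functions, an ideal `D` is dense only if the union `V` of the supports of its members is dense.
The quotients `φ d / d` agree where they overlap and glue to a `C^k` function `G` on `V`. A damping
function `h` with support exactly `V`, so small near the boundary that `h * G` is `C^k` on the line,
gives `φ = (h * G) / h` (`exists_contDiff_support_eq_contDiff_mul`). The same damping shows that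
every element of the limit over dense open sets is a fraction.

Algebraically, the property makes the complete ring a localization at the non-zero-divisors. An
element `b` of a flat epimorphic extension has a dense ideal of denominators, so `d ↦ d * b` is a
fraction, and the extension embeds in `Q_cl`. With `A` reduced, Baer's criterion for `Q_cl` also
reduces to homomorphisms on dense ideals of `A`. Regularity is separate: each `a` has a `b` with `a
* b = 0` and `a ^ 2 + b` a non-zero-divisor. -/

namespace RingsOfQuotients

open scoped nonZeroDivisors TensorProduct Topology

/-! ### Commutative rings in which homomorphisms on dense ideals are fractions -/

section Algebra

variable {A : Type u} [CommRing A]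

/-- Every `A`-linear map from a dense ideal to `A` is multiplication by a fraction. -/
def HomsAreFractions (A : Type u) [CommRing A] : Prop :=
  ∀ (D : Ideal A), IsDenseIdeal D → ∀ φ : D →ₗ[A] A,
    ∃ s ∈ A⁰, ∃ a : A, ∀ d : D, s * φ d = a * d

theorem CompleteRingOfQuotients.ofElem_injective :
    Function.Injective (CompleteRingOfQuotients.ofElem : A → CompleteRingOfQuotients A) := by
  intro a b h
  obtain ⟨E, _, _, h⟩ := Quotient.exact h
  rw [← sub_eq_zero]
  refine E.dense _ fun d hd ↦ ?_
  have := LinearMap.congr_fun h ⟨d, hd⟩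
  rw [sub_mul, sub_eq_zero]
  exact this

/-- The ideal `sA` is dense, and the inverse is the class of division by `s` on it. -/
theorem CompleteRingOfQuotients.isUnit_ofElem {s : A} (hs : s ∈ A⁰) :
    IsUnit (CompleteRingOfQuotients.ofElem s) := by
  have hinj : Function.Injective (LinearMap.mulLeft A s) := fun x y hxy ↦
    (mul_cancel_left_mem_nonZeroDivisors hs).1 hxy
  let e := LinearEquiv.ofInjective _ hinj
  let D : DenseIdeals A := OrderDual.toDual ⟨LinearMap.range (LinearMap.mulLeft A s), fun r hr ↦ by
    have := hr s ⟨1, by simp⟩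
    exact (mul_right_mem_nonZeroDivisors_eq_zero_iff hs).1 this⟩
  let φ : D.Hom := e.symm.toLinearMap
  refine IsUnit.of_mul_eq_one (mk D φ) ?_
  rw [ofElem_eq s D, mk_mul]
  refine Eq.trans ?_ (ofElem_eq 1 (D.prod D)).symm
  congr 1
  ext x
  have hx : (x : A) ∈ D.ideal := Ideal.mul_le_left x.2
  have : s * e.symm ⟨x, hx⟩ = x := congrArg Subtype.val (e.apply_symm_apply ⟨x, hx⟩)
  exact this.trans (one_smul A (x : A)).symm

theorem HomsAreFractions.isLocalization (h : HomsAreFractions A) :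
    IsLocalization A⁰ (CompleteRingOfQuotients A) where
  map_units s := CompleteRingOfQuotients.isUnit_ofElem s.2
  exists_of_eq {a b} hab := ⟨1, by rw [CompleteRingOfQuotients.ofElem_injective hab]⟩
  surj z := by
    obtain ⟨D, φ, rfl⟩ : ∃ D φ, z = CompleteRingOfQuotients.mk D φ :=
      CompleteRingOfQuotients.induction₃ (C := fun x _ _ ↦ ∃ D φ, x = .mk D φ)
        (fun D φ _ _ ↦ ⟨D, φ, rfl⟩) z z z
    obtain ⟨s, hs, a, hsa⟩ := h D.ideal D.dense φ
    refine ⟨(a, ⟨s, hs⟩), ?_⟩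
    change CompleteRingOfQuotients.mk D φ * .ofElem s = .ofElem a
    rw [CompleteRingOfQuotients.ofElem_eq s D, CompleteRingOfQuotients.mk_mul,
      CompleteRingOfQuotients.ofElem_eq a (D.prod D)]
    congr 1
    ext x
    have hx : (x : A) ∈ D.ideal := Ideal.mul_le_left x.2
    have := φ.map_smul s ⟨x, hx⟩
    exact this.trans (hsa ⟨x, hx⟩)

/-! ### Self-injectivity and regularity of the classical ring of quotients -/

section Localization

variable {Q : Type u} [CommRing Q] [Algebra A Q] [IsLocalization A⁰ Q]

/-- Baer's criterion: extend `f : I → Q` by zero to `I + J`, with `J` the annihilator of `I`; the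
sum is direct because `Q` is reduced. On the elements of `A` where this extension takes values in
`A` it is a homomorphism on a dense ideal, hence a fraction, and multiplication by that fraction
extends `f`. -/
theorem isSelfInjective_of_homsAreFractions [IsReduced A] (h : HomsAreFractions A) :
    IsSelfInjective Q := by
  have hAQ : Function.Injective (algebraMap A Q) := IsLocalization.injective Q le_rfl
  have sq : ∀ q : Q, q * q = 0 → q = 0 := by
    intro q hq
    obtain ⟨⟨a, t⟩, ht⟩ := IsLocalization.surj A⁰ q
    dsimp only at ht
    have ha : a * a = 0 := hAQ <| by
      rw [map_mul, map_zero, ← ht]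
      linear_combination (algebraMap A Q t) ^ 2 * hq
    have ha0 : a = 0 := IsNilpotent.eq_zero ⟨2, by rw [pow_two, ha]⟩
    rw [ha0, map_zero] at ht
    exact (IsLocalization.map_units Q t).mul_left_eq_zero.1 ht
  refine Module.Baer.injective fun I f ↦ ?_
  let J : Ideal Q := Submodule.annihilator I
  have hIJ : ∀ i ∈ I, ∀ j ∈ J, i * j = 0 := fun i hi j hj ↦ by
    rw [mul_comm]; exact Submodule.mem_annihilator.1 hj i hi
  -- the graph of the extension of `f` by zero on the annihilator of `I`
  let D : Ideal A :=
    { carrier := {d | ∃ i : I, ∃ j ∈ J, ∃ a : A, algebraMap A Q d = i + j ∧ f i = algebraMap A Q a}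
      add_mem' := by
        rintro x y ⟨i, j, hj, a, h1, h2⟩ ⟨i', j', hj', a', h1', h2'⟩
        refine ⟨i + i', j + j', J.add_mem hj hj', a + a', ?_, ?_⟩
        · rw [map_add, h1, h1']; push_cast; ring
        · rw [map_add, map_add, h2, h2']
      zero_mem' := ⟨0, 0, J.zero_mem, 0, by simp, by simp⟩
      smul_mem' := by
        rintro r x ⟨i, j, hj, a, h1, h2⟩
        refine ⟨algebraMap A Q r • i, algebraMap A Q r * j, J.mul_mem_left _ hj, r * a, ?_, ?_⟩
        · rw [smul_eq_mul, map_mul, h1]; simp [mul_add, Algebra.smul_def]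
        · rw [map_smul, h2, map_mul, smul_eq_mul] }
  have uniq : ∀ (i i' : I), ∀ j ∈ J, ∀ j' ∈ J, (i : Q) + j = i' + j' → i = i' := by
    intro i i' j hj j' hj' hh
    have h1 : (i : Q) - i' = j' - j := by linear_combination hh
    have h2 : ((i : Q) - i') * (j' - j) = 0 :=
      hIJ _ (I.sub_mem i.2 i'.2) _ (J.sub_mem hj' hj)
    rw [← h1] at h2
    exact Subtype.ext (sub_eq_zero.1 (sq _ h2))
  choose i j hj a hd hf using fun d : D ↦ d.2
  let φ : D →ₗ[A] A :=
    { toFun := a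
      map_add' x y := by
        apply hAQ
        rw [map_add, ← hf, ← hf, ← hf, ← map_add]
        congr 1
        refine uniq _ _ _ (hj (x + y)) _ (J.add_mem (hj x) (hj y)) ?_
        rw [← hd, Submodule.coe_add, map_add, hd, hd]; push_cast; ring
      map_smul' r x := by
        apply hAQ
        rw [RingHom.id_apply, smul_eq_mul, map_mul, ← hf, ← hf, ← smul_eq_mul, ← map_smul]
        congr 1
        refine uniq _ _ _ (hj (r • x)) _ (J.mul_mem_left (algebraMap A Q r) (hj x)) ?_
        rw [← hd, Submodule.coe_smul, smul_eq_mul, map_mul, hd]; simp [mul_add, Algebra.smul_def] }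
  have clear : ∀ x : I, ∃ t ∈ A⁰, ∃ d : D, algebraMap A Q d = algebraMap A Q t * x ∧
      algebraMap A Q (φ d) = algebraMap A Q t * f x := by
    intro x
    obtain ⟨⟨c, t⟩, ht⟩ := IsLocalization.surj A⁰ (x : Q)
    obtain ⟨⟨c', t'⟩, ht'⟩ := IsLocalization.surj A⁰ (f x)
    dsimp only at ht ht'
    have hmem : t' * c ∈ D := by
      refine ⟨algebraMap A Q (t * t') • x, 0, J.zero_mem, t * c', ?_, ?_⟩
      · simp only [map_mul, ← ht, Submodule.coe_smul, smul_eq_mul]; ring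
      · rw [map_smul, smul_eq_mul, map_mul, map_mul, ← ht']; ring
    refine ⟨t * t', mul_mem t.2 t'.2, ⟨t' * c, hmem⟩, ?_, ?_⟩
    · simp only [map_mul, ← ht]; ring
    · rw [← smul_eq_mul (algebraMap A Q (t * t')), ← map_smul f]
      refine (hf ⟨t' * c, hmem⟩).symm.trans ?_
      congr 1
      refine uniq _ _ _ (hj ⟨t' * c, hmem⟩) 0 J.zero_mem ?_
      rw [← hd]
      simp only [map_mul, ← ht, Submodule.coe_smul, smul_eq_mul]; ring
  have hD : IsDenseIdeal D := by
    intro r hr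
    apply hAQ
    rw [map_zero]
    -- Killing `D` forces `r` to kill `I`, after clearing denominators. Then `r` itself lies in `D`,
    -- so `r * r = 0`.
    have hrJ : algebraMap A Q r ∈ J := by
      refine Submodule.mem_annihilator.2 fun x hx ↦ ?_
      obtain ⟨t, ht, d, hd, -⟩ := clear ⟨x, hx⟩
      refine ((IsLocalization.map_units Q ⟨t, ht⟩).mul_right_eq_zero).1 ?_
      have := congrArg (algebraMap A Q) (hr d d.2)
      rw [map_mul, map_zero, hd] at this
      rw [smul_eq_mul]; linear_combination this
    have : r ∈ D := ⟨0, _, hrJ, 0, by simp, by simp⟩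
    have := congrArg (algebraMap A Q) (hr r this)
    rw [map_mul, map_zero] at this
    exact sq _ this
  obtain ⟨s, hs, b, hsb⟩ := h D hD φ
  obtain ⟨u, hu⟩ := IsLocalization.map_units Q (⟨s, hs⟩ : A⁰)
  refine ⟨LinearMap.mulLeft Q (↑u⁻¹ * algebraMap A Q b), fun x hx ↦ ?_⟩
  obtain ⟨t, ht, d, hd, hφ⟩ := clear ⟨x, hx⟩
  have key := congrArg (algebraMap A Q) (hsb d)
  rw [map_mul, map_mul, hφ, hd, ← hu] at key
  rw [LinearMap.mulLeft_apply]
  refine (IsLocalization.map_units Q ⟨t, ht⟩).mul_left_cancel ?_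
  have hu' := u.inv_mul
  dsimp only at key ⊢
  linear_combination (-(↑u⁻¹ : Q)) * key + (algebraMap A Q t * f ⟨x, hx⟩) * hu'

theorem isVonNeumannRegular_of_exists_add_mem_nonZeroDivisors
    (h : ∀ a : A, ∃ b, a * b = 0 ∧ a ^ 2 + b ∈ A⁰) : IsVonNeumannRegular Q := by
  intro q
  obtain ⟨⟨a, t⟩, hq⟩ := IsLocalization.surj A⁰ q
  obtain ⟨b, hab, hs⟩ := h a
  obtain ⟨u, hu⟩ := IsLocalization.map_units Q (⟨_, hs⟩ : A⁰)
  obtain ⟨v, hv⟩ := IsLocalization.map_units Q t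
  have hab' := congrArg (algebraMap A Q) hab
  dsimp only at hq hu
  rw [map_mul, map_zero, ← hq, ← hv] at hab'
  rw [map_add, map_pow, ← hq, ← hv] at hu
  have hqb : q * algebraMap A Q b = 0 := by
    have h3 := v.inv_mul
    linear_combination (↑v⁻¹ : Q) * hab' - (q * algebraMap A Q b) * h3
  -- Here `u = (q * v) ^ 2 + b` and `q * b = 0`, so `q * (v ^ 2 * q) * q = q * u`.
  refine ⟨v ^ 2 * q * ↑u⁻¹, ?_⟩
  have h3 := u.inv_mul
  linear_combination q * h3 - q * (↑u⁻¹ : Q) * hu - (↑u⁻¹ : Q) * hqb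

end Localization

/-! ### Epimorphisms -/

/-- The codomain of an epimorphism of rings with commutative domain is commutative. -/
theorem IsRingEpi.mul_comm {B : Type u} [Ring B] {e : A →+* B} (he : IsRingEpi e) (x y : B) :
    x * y = y * x := by
  -- If `x` commutes with the image of `A`, the inner derivation `[x, ·]` vanishes there, so `b ↦ b
  -- + ε[x, b]` and `b ↦ b` agree on `A`, hence everywhere. This is applied first to `x = e a`, then
  -- to arbitrary `x`.
  have key : ∀ x : B, (∀ a, x * e a = e a * x) → ∀ y, x * y = y * x := by
    intro x hx y
    let f : B →+* TrivSqZeroExt B B := TrivSqZeroExt.inlHom B B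
    let g : B →+* TrivSqZeroExt B B :=
      { toFun b := TrivSqZeroExt.inl b + TrivSqZeroExt.inr (x * b - b * x)
        map_one' := by simp
        map_mul' b c := by
          ext
          · simp
          · simp; noncomm_ring
        map_zero' := by simp
        map_add' b c := by
          ext
          · simp
          · simp; noncomm_ring }
    have hfg : f = g := he _ f g <| by
      ext a
      · simp [f, g]
      · simp [f, g, hx a]
    have := congrArg TrivSqZeroExt.snd (RingHom.congr_fun hfg y)
    simp [f, g] at this
    exact sub_eq_zero.1 this.symm
  have hc : ∀ (a : A) (y : B), e a * y = y * e a := fun a ↦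
    key (e a) fun b ↦ by rw [← map_mul, ← map_mul, _root_.mul_comm]
  exact key x (fun a ↦ (hc a x).symm) y

/-- An element `b` of a flat epimorphic extension `B` of `A` has a denominator ideal generating
the unit ideal of `B`. -/
theorem exists_sum_smul_eq_one_of_flat {B : Type u} [CommRing B] [Algebra A B] [Module.Flat A B]
    (he : IsRingEpi (algebraMap A B)) (b : B) :
    ∃ (n : ℕ) (r : Fin n → A) (y : Fin n → B), 1 = ∑ j, r j • y j ∧
      ∀ j, ∃ a : A, r j • b = algebraMap A B a := by
  have hb : b ⊗ₜ[A] (1 : B) = 1 ⊗ₜ[A] b := by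
    have := he (B ⊗[A] B) (Algebra.TensorProduct.includeLeft : B →ₐ[A] B ⊗[A] B).toRingHom
      (Algebra.TensorProduct.includeRight : B →ₐ[A] B ⊗[A] B).toRingHom <| by
        ext a
        exact Algebra.TensorProduct.tmul_one_eq_one_tmul (R := A) (A := B) (B := B) a
    exact RingHom.congr_fun this b
  -- In `(B / A) ⊗ B` the element `b ⊗ 1` equals `1 ⊗ b = 0`. Since `B` is flat, the equational
  -- criterion for vanishing supplies the `r j` and `y j`.
  let M : Submodule A B := LinearMap.range (Algebra.linearMap A B)
  have h0 : ∑ i : Fin 1, (fun _ ↦ M.mkQ b) i ⊗ₜ[A] (fun _ ↦ (1 : B)) i = 0 := by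
    have h1 := congrArg (M.mkQ.rTensor B) hb
    have h2 : M.mkQ (1 : B) = 0 := (Submodule.Quotient.mk_eq_zero M).2 ⟨1, by simp⟩
    rw [LinearMap.rTensor_tmul, LinearMap.rTensor_tmul, h2, TensorProduct.zero_tmul] at h1
    simpa using h1
  obtain ⟨n, r, y, h1, h2⟩ :=
    TensorProduct.vanishesTrivially_of_sum_tmul_eq_zero_of_rTensor_injective A
      (Module.Flat.rTensor_preserves_injective_linearMap _ Subtype.val_injective) h0
  refine ⟨n, r 0, y, h1 0, fun j ↦ ?_⟩
  have := h2 j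
  rw [Fin.sum_univ_one, ← map_smul] at this
  obtain ⟨a, ha⟩ := (Submodule.Quotient.mk_eq_zero M).1 this
  exact ⟨a, ha.symm⟩

/-- Elements of flat epimorphic extensions are fractions. -/
theorem HomsAreFractions.exists_smul_eq (h : HomsAreFractions A) {B : Type u} [CommRing B]
    [Algebra A B] [Module.Flat A B] (hinj : Function.Injective (algebraMap A B))
    (he : IsRingEpi (algebraMap A B)) (b : B) :
    ∃ s ∈ A⁰, ∃ a : A, s • b = algebraMap A B a := by
  obtain ⟨n, r, y, h1, h2⟩ := exists_sum_smul_eq_one_of_flat he b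
  -- The denominators of `b`. They include all `r j`, which generate the unit ideal of `B`; hence
  -- `D` is dense.
  let D : Ideal A := Submodule.comap (LinearMap.toSpanSingleton A B b)
    (LinearMap.range (Algebra.linearMap A B))
  have hr : ∀ j, r j ∈ D := fun j ↦ by
    obtain ⟨a, ha⟩ := h2 j
    exact ⟨a, ha.symm⟩
  have zero_of : ∀ z : B, (∀ j, r j • z = 0) → z = 0 := fun z hz ↦ by
    rw [← mul_one z, h1, Finset.mul_sum]
    refine Finset.sum_eq_zero fun j _ ↦ ?_
    rw [mul_smul_comm, ← smul_mul_assoc, hz, zero_mul]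
  have hD : IsDenseIdeal D := fun t ht ↦ by
    apply hinj
    rw [map_zero]
    refine zero_of _ fun j ↦ ?_
    rw [Algebra.smul_def, ← map_mul, mul_comm, ht _ (hr j), map_zero]
  choose a ha using fun d : D ↦ d.2
  have ha' : ∀ d : D, algebraMap A B (a d) = (d : A) • b := ha
  let φ : D →ₗ[A] A :=
    { toFun := a
      map_add' x y := hinj <| by simp [ha', add_smul]
      map_smul' t x := hinj <| by simp [ha', Algebra.smul_def, mul_assoc] }
  obtain ⟨s, hs, c, hc⟩ := h D hD φ
  refine ⟨s, hs, c, sub_eq_zero.1 (zero_of _ fun j ↦ ?_)⟩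
  have h3 := congrArg (algebraMap A B) (hc ⟨r j, hr j⟩)
  rw [map_mul, map_mul] at h3
  change _ * algebraMap A B (a _) = _ at h3
  rw [ha'] at h3
  simp only [Algebra.smul_def] at h3 ⊢
  linear_combination h3

/-- By flatness non-zero-divisors of `A` stay regular on `B`, so `B` and `Q` both embed in the
localization of `B` at them. There the image of `B` lies in that of `Q`. -/
theorem HomsAreFractions.exists_embedding (h : HomsAreFractions A) {Q : Type u} [CommRing Q]
    [Algebra A Q] [IsLocalization A⁰ Q] {B : Type u} [CommRing B]
    [Algebra A B] [Module.Flat A B] (hinj : Function.Injective (algebraMap A B))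
    (he : IsRingEpi (algebraMap A B)) :
    ∃ j : B →+* Q, Function.Injective j ∧ j.comp (algebraMap A B) = algebraMap A Q := by
  let S : Submonoid B := Algebra.algebraMapSubmonoid B A⁰
  have hS : S ≤ B⁰ := by
    rintro _ ⟨s, hs, rfl⟩
    rw [mem_nonZeroDivisors_iff_right]
    intro z hz
    have : IsSMulRegular B s := Module.Flat.isSMulRegular_of_nonZeroDivisors hs
    refine this ?_
    dsimp only
    rw [smul_zero, Algebra.smul_def, mul_comm, hz]
  have hBT : Function.Injective (algebraMap B (Localization S)) :=
    IsLocalization.injective _ hS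
  have hu : ∀ s : A⁰, IsUnit (((algebraMap B (Localization S)).comp (algebraMap A B)) s) :=
    fun s ↦ IsLocalization.map_units (Localization S)
      (⟨_, Algebra.mem_algebraMapSubmonoid_of_mem s⟩ : S)
  let f : Q →+* Localization S := IsLocalization.lift hu
  have hfa : ∀ a, f (algebraMap A Q a) = algebraMap B (Localization S) (algebraMap A B a) :=
    fun a ↦ IsLocalization.lift_eq hu a
  have hf : Function.Injective f := by
    rw [injective_iff_map_eq_zero]
    intro q hq
    obtain ⟨⟨a, s⟩, hs⟩ := IsLocalization.surj A⁰ q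
    have h1 := congrArg f hs
    rw [map_mul, hq, zero_mul, hfa] at h1
    have h2 : a = 0 := (hBT.comp hinj) (by simpa using h1.symm)
    dsimp only at hs
    rw [h2, map_zero] at hs
    exact ((IsLocalization.map_units Q s).mul_left_eq_zero).1 hs
  have hrange : ∀ b, ∃ q, f q = algebraMap B (Localization S) b := by
    intro b
    obtain ⟨s, hs, a, hsa⟩ := h.exists_smul_eq hinj he b
    obtain ⟨u, hu'⟩ := IsLocalization.map_units Q (⟨s, hs⟩ : A⁰)
    refine ⟨↑u⁻¹ * algebraMap A Q a, (hu ⟨s, hs⟩).mul_left_cancel ?_⟩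
    have h1 : f u * f ↑u⁻¹ = 1 := by rw [← map_mul, u.mul_inv, map_one]
    rw [hu', hfa] at h1
    rw [Algebra.smul_def] at hsa
    have h2 := congrArg (algebraMap B (Localization S)) hsa
    rw [map_mul, ← hfa a] at h2
    simp only [RingHom.comp_apply, map_mul]
    rw [h2, ← mul_assoc, h1, one_mul]
  choose j hj using hrange
  refine ⟨{ toFun := j, map_one' := hf (by simp [hj]), map_mul' := fun _ _ ↦ hf (by simp [hj]),
            map_zero' := hf (by simp [hj]), map_add' := fun _ _ ↦ hf (by simp [hj]) },
    fun x y hxy ↦ hBT ?_, ?_⟩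
  · rw [← hj, ← hj]; exact congrArg f hxy
  · ext a
    exact hf ((hj _).trans (hfa a).symm)

theorem isFlatEpiExtension_of_isLocalization {Q : Type u} [CommRing Q] [Algebra A Q]
    [IsLocalization A⁰ Q] : IsFlatEpiExtension (algebraMap A Q) where
  injective := IsLocalization.injective Q le_rfl
  flat := by
    have h : Module.Flat A Q := IsLocalization.flat Q A⁰
    have hm : Module.compHom Q (algebraMap A Q) = Algebra.toModule := by
      ext a q
      exact (Algebra.smul_def a q).symm
    unfold IsFlatHom
    rw [hm]
    exact h
  epi C _ f g hfg := by
    ext q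
    obtain ⟨⟨a, s⟩, hs⟩ := IsLocalization.surj A⁰ q
    have hu := (IsLocalization.map_units Q s).map f
    have hfg' : ∀ a, f (algebraMap A Q a) = g (algebraMap A Q a) := RingHom.congr_fun hfg
    refine hu.mul_right_cancel ?_
    rw [← map_mul, hfg' s, ← map_mul, hs]
    exact hfg' a

theorem HomsAreFractions.isMaximalFlatEpiExtension (h : HomsAreFractions A) {Q : Type u}
    [CommRing Q] [Algebra A Q] [IsLocalization A⁰ Q] :
    IsMaximalFlatEpiExtension (algebraMap A Q) where
  isFlatEpiExtension := isFlatEpiExtension_of_isLocalization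
  existsUnique_embedding B _ b hb := by
    let : CommRing B := { mul_comm := hb.epi.mul_comm }
    let : Algebra A B := b.toAlgebra
    have : Module.Flat A B := hb.flat
    obtain ⟨j, hj, hjb⟩ := h.exists_embedding (Q := Q) (B := B) hb.injective hb.epi
    exact ⟨j, hj, hjb, fun j' hj' ↦ hb.epi Q j' j (hj'.trans hjb.symm)⟩

end Algebra

open Function Set

/-! ### Extending functions by zero after damping -/

section Damping

variable {k : ℕ∞}

theorem exists_forall_norm_iteratedFDeriv_le {u : ℝ → ℝ} (hu : ContDiff ℝ k u)
    (hc : HasCompactSupport u) (n : ℕ) :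
    ∃ M : ℝ, 0 ≤ M ∧ ∀ i ≤ n, (i : ℕ∞) ≤ k → ∀ x, ‖iteratedFDeriv ℝ i u x‖ ≤ M := by
  have h : ∀ i : ℕ, ∃ R : ℝ, 0 ≤ R ∧ ((i : ℕ∞) ≤ k → ∀ x, ‖iteratedFDeriv ℝ i u x‖ ≤ R) := by
    intro i
    by_cases hi : (i : ℕ∞) ≤ k
    · obtain ⟨R, hR⟩ := (hu.continuous_iteratedFDeriv
        (mod_cast hi)).norm.bddAbove_range_of_hasCompactSupport
          ((hc.iteratedFDeriv i).comp_left norm_zero)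
      exact ⟨R, (norm_nonneg _).trans (hR ⟨0, rfl⟩), fun _ x ↦ hR ⟨x, rfl⟩⟩
    · exact ⟨0, le_rfl, fun h ↦ absurd h hi⟩
  choose R hR0 hR using h
  refine ⟨∑ i ∈ Finset.range (n + 1), R i, Finset.sum_nonneg fun i _ ↦ hR0 i,
    fun i hi hik x ↦ (hR i hik x).trans ?_⟩
  exact Finset.single_le_sum (fun i _ ↦ hR0 i) (Finset.mem_range.2 (Nat.lt_succ_of_le hi))

/-- At a point outside `V` the factor `g` vanishes on a neighbourhood, so the values of `G` off `V`
are harmless. -/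
theorem contDiff_mul_of_tsupport_subset {V : Set ℝ} (hV : IsOpen V) {g G : ℝ → ℝ}
    (hg : ContDiff ℝ k g) (hG : ContDiffOn ℝ k G V) (hgV : tsupport g ⊆ V) :
    ContDiff ℝ k (g * G) := by
  rw [contDiff_iff_contDiffAt]
  intro x
  by_cases hx : x ∈ V
  · exact hg.contDiffAt.mul (hG.contDiffAt (hV.mem_nhds hx))
  · have h0 : g * G =ᶠ[𝓝 x] fun _ ↦ 0 := by
      filter_upwards [notMem_tsupport_iff_eventuallyEq.1 (fun h ↦ hx (hgV h))] with y hy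
      simp [hy]
    exact contDiffAt_const.congr_of_eventuallyEq h0

theorem contDiff_tsum_smul {u : ℕ → ℝ → ℝ} {r M : ℕ → ℝ} (hu : ∀ n, ContDiff ℝ k (u n))
    (hM : ∀ n : ℕ, ∀ i : ℕ, i ≤ n → (i : ℕ∞) ≤ k → ∀ x, ‖iteratedFDeriv ℝ i (u n) x‖ ≤ M n)
    (hr : ∀ n, 0 ≤ r n) (hrM : ∀ n, r n * M n ≤ (1 / 2) ^ n) :
    (∀ x, Summable fun n ↦ r n * u n x) ∧ ContDiff ℝ k fun x ↦ ∑' n, r n * u n x := by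
  have hbound : ∀ n : ℕ, ∀ i : ℕ, i ≤ n → (i : ℕ∞) ≤ k → ∀ x,
      ‖iteratedFDeriv ℝ i (fun x ↦ r n * u n x) x‖ ≤ (1 / 2) ^ n := by
    intro n i hi hik x
    have h1 : iteratedFDeriv ℝ i (fun x ↦ r n * u n x) x = r n • iteratedFDeriv ℝ i (u n) x :=
      iteratedFDeriv_const_smul_apply (a := r n)
        ((hu n).contDiffAt.of_le (mod_cast hik))
    rw [h1, norm_smul, Real.norm_of_nonneg (hr n)]
    exact (mul_le_mul_of_nonneg_left (hM n i hi hik x) (hr n)).trans (hrM n)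
  refine ⟨fun x ↦ .of_norm_bounded summable_geometric_two fun n ↦ ?_, ?_⟩
  · simpa only [norm_iteratedFDeriv_zero] using hbound n 0 (Nat.zero_le _) (by simp) x
  · refine contDiff_tsum_of_eventually (v := fun _ n ↦ (1 / 2) ^ n)
      (fun n ↦ contDiff_const.mul (hu n)) (fun _ _ ↦ summable_geometric_two) fun i hi ↦ ?_
    rw [Nat.cofinite_eq_atTop, Filter.eventually_atTop]
    -- The `n`-th term is controlled only up to order `n`; for order `i` this omits just the
    -- finitely many terms `n < i`.
    exact ⟨i, fun n hn x ↦ hbound n i hn (mod_cast hi) x⟩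

/-- A `C^k` function on an open set `V` becomes, after multiplication by a suitable `C^k` function
with support `V`, the restriction of a `C^k` function on the line. -/
theorem exists_contDiff_support_eq_contDiff_mul {V : Set ℝ} (hV : IsOpen V) {G : ℝ → ℝ}
    (hG : ContDiffOn ℝ k G V) :
    ∃ h : ℝ → ℝ, support h = V ∧ ContDiff ℝ k h ∧ ContDiff ℝ k (h * G) := by
  rcases V.eq_empty_or_nonempty with rfl | hne
  · exact ⟨0, support_zero, contDiff_const, by rw [zero_mul]; exact contDiff_const⟩
  -- Compactly supported bumps inside `V`, one for each point; by Lindelöf countably many of their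
  -- supports cover `V`.
  choose f hfV hfc hfs hf01 hf1 using fun x : V ↦
    exists_contDiff_tsupport_subset (n := k) (hV.mem_nhds x.2)
  obtain ⟨T, hT, hTV⟩ := TopologicalSpace.isOpen_iUnion_countable (fun x : V ↦ support (f x))
    fun x ↦ (hfs x).continuous.isOpen_support
  have hcover : ∀ x ∈ V, ∃ t ∈ T, f t x ≠ 0 := by
    intro x hx
    have : x ∈ ⋃ t ∈ T, support (f t) := by
      rw [hTV]
      exact mem_iUnion_of_mem ⟨x, hx⟩ (by simp [hf1])
    simpa using this
  obtain ⟨t₀, ht₀, -⟩ := hcover _ hne.some_mem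
  obtain ⟨e, rfl⟩ := hT.exists_eq_range ⟨t₀, ht₀⟩
  have hmul := fun n ↦ contDiff_mul_of_tsupport_subset hV (hfs (e n)) hG (hfV (e n))
  choose M hM0 hM using fun n ↦ exists_forall_norm_iteratedFDeriv_le (hfs (e n)) (hfc (e n)) n
  choose N hN0 hN using fun n ↦ exists_forall_norm_iteratedFDeriv_le (hmul n) (hfc (e n)).mul_right n
  -- Weights small enough for the derivatives of both the `n`-th bump and its product with `G`; the
  -- `1` keeps the denominator positive.
  let r : ℕ → ℝ := fun n ↦ (1 / 2) ^ n / (M n + N n + 1)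
  have hpos : ∀ n, 0 < M n + N n + 1 := fun n ↦ by linarith [hM0 n, hN0 n]
  have hr : ∀ n, 0 < r n := fun n ↦ div_pos (by positivity) (hpos n)
  have hrle : ∀ n x, x ≤ M n + N n + 1 → r n * x ≤ (1 / 2) ^ n := fun n x hx ↦ by
    have h1 : r n * (M n + N n + 1) = (1 / 2) ^ n := div_mul_cancel₀ _ (hpos n).ne'
    exact h1 ▸ mul_le_mul_of_nonneg_left hx (hr n).le
  obtain ⟨hsum, hcd⟩ := contDiff_tsum_smul (fun n ↦ hfs (e n)) hM (fun n ↦ (hr n).le)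
    fun n ↦ hrle n (M n) (by linarith [hN0 n])
  obtain ⟨-, hcd'⟩ := contDiff_tsum_smul hmul hN (fun n ↦ (hr n).le)
    fun n ↦ hrle n (N n) (by linarith [hM0 n])
  have hnonneg : ∀ n x, 0 ≤ f (e n) x := fun n x ↦ (hf01 (e n) ⟨x, rfl⟩).1
  refine ⟨_, Subset.antisymm (fun x hx ↦ ?_) (fun x hx ↦ ?_), hcd, ?_⟩
  · by_contra hxV
    have h0 : ∀ n, f (e n) x = 0 := fun n ↦ image_eq_zero_of_notMem_tsupport fun h ↦ hxV (hfV _ h)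
    exact hx (by simp [h0])
  · obtain ⟨_, ⟨n, rfl⟩, hn⟩ := hcover x hx
    exact ((hsum x).tsum_pos (fun i ↦ mul_nonneg (hr i).le (hnonneg i x)) n
      (mul_pos (hr n) ((hnonneg n x).lt_of_ne' hn))).ne'
  · convert hcd' using 1
    ext x
    simp only [Pi.mul_apply, ← tsum_mul_right, mul_assoc]

end Damping

/-! ### The rings `C^k(ℝ)` -/

namespace Ck

variable {k : ℕ∞}

theorem continuous (f : Ck k) : Continuous f.1 := (contDiff f).continuous

theorem eq_of_eqOn_dense {a b : Ck k} {s : Set ℝ} (hs : Dense s) (h : EqOn a.1 b.1 s) : a = b :=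
  Subtype.ext (Continuous.ext_on hs (continuous a) (continuous b) h)

theorem exists_support_eq {V : Set ℝ} (hV : IsOpen V) : ∃ r : Ck k, support r.1 = V := by
  obtain ⟨r, hr, hr', -⟩ := hV.exists_contDiff_support_eq (n := k)
  exact ⟨⟨r, hr'⟩, hr⟩

theorem mem_nonZeroDivisors_of_dense {s : Ck k} (hs : Dense (support s.1)) : s ∈ (Ck k)⁰ := by
  rw [mem_nonZeroDivisors_iff_right]
  intro r hr
  refine eq_of_eqOn_dense hs fun x hx ↦ ?_
  exact (mul_eq_zero.1 (congrFun (congrArg Subtype.val hr) x)).resolve_right hx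

/-- If the supports missed a nonempty open `U`, a function with support `U` would annihilate `D`. -/
theorem dense_iUnion_support {D : Ideal (Ck k)} (hD : IsDenseIdeal D) :
    Dense (⋃ d : D, support d.1.1) := by
  rw [dense_iff_inter_open]
  intro U hU hne
  by_contra hempty
  rw [not_nonempty_iff_eq_empty] at hempty
  obtain ⟨r, hr⟩ := exists_support_eq (k := k) hU
  have hr0 : r = 0 := hD r fun d hd ↦ Subtype.ext <| funext fun x ↦ by
    by_contra hx
    obtain ⟨h1, h2⟩ := mul_ne_zero_iff.1 hx
    exact hempty.le ⟨hr ▸ h1, mem_iUnion_of_mem ⟨d, hd⟩ h2⟩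
  obtain ⟨x, hx⟩ := hne
  rw [← hr, hr0] at hx
  exact hx rfl

theorem dense_support_of_mem_nonZeroDivisors {s : Ck k} (hs : s ∈ (Ck k)⁰) :
    Dense (support s.1) := by
  have hD : IsDenseIdeal (Ideal.span {s}) := fun r hr ↦
    (mul_right_mem_nonZeroDivisors_eq_zero_iff hs).1 (hr s (Ideal.mem_span_singleton_self s))
  refine (dense_iUnion_support hD).mono (iUnion_subset fun ⟨d, hd⟩ x hx ↦ ?_)
  obtain ⟨c, rfl⟩ := Ideal.mem_span_singleton'.1 hd
  exact (mul_ne_zero_iff.1 hx).2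

theorem homsAreFractions : HomsAreFractions (Ck k) := by
  intro D hD φ
  have comm : ∀ (d e : D) (x : ℝ), (φ d).1 x * e.1.1 x = (φ e).1 x * d.1.1 x := by
    intro d e x
    have h1 := φ.map_smul e.1 d
    have h2 := φ.map_smul d.1 e
    have h3 : e.1 • d = d.1 • e := Subtype.ext (mul_comm _ _)
    rw [h3, h2] at h1
    have := congrFun (congrArg Subtype.val h1) x
    exact (mul_comm _ _).trans (this.symm.trans (mul_comm _ _))
  let V : Set ℝ := ⋃ d : D, support d.1.1
  have hV : IsOpen V := isOpen_iUnion fun d ↦ (continuous d.1).isOpen_support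
  have hVd : Dense V := dense_iUnion_support hD
  choose d hd using fun x : V ↦ mem_iUnion.1 x.2
  classical
  -- The choice of `d` at each point need not be continuous: by `comm` the quotient does not depend
  -- on it, so near a point `G` equals `φ e / e` for one fixed `e`.
  let G : ℝ → ℝ := fun x ↦ if hx : x ∈ V then (φ (d ⟨x, hx⟩)).1 x / (d ⟨x, hx⟩).1.1 x else 0
  have hGe : ∀ (e : D) (x : ℝ), x ∈ V → G x * e.1.1 x = (φ e).1 x := by
    intro e x hx
    have h0 : (d ⟨x, hx⟩).1.1 x ≠ 0 := hd ⟨x, hx⟩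
    simp only [G, dif_pos hx]
    rw [div_mul_eq_mul_div, div_eq_iff h0]
    exact comm _ _ _
  have hG : ContDiffOn ℝ k G V := by
    intro x hx
    obtain ⟨e, he⟩ := mem_iUnion.1 hx
    have hquot : ContDiffAt ℝ k (fun y ↦ (φ e).1 y / e.1.1 y) x :=
      (contDiff (φ e)).contDiffAt.div (contDiff e.1).contDiffAt he
    refine (hquot.congr_of_eventuallyEq ?_).contDiffWithinAt
    filter_upwards [(continuous e.1).isOpen_support.mem_nhds he] with y hy
    rw [eq_div_iff hy]
    exact hGe e y (mem_iUnion_of_mem e hy)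
  obtain ⟨h, hsupp, hh, hhG⟩ := exists_contDiff_support_eq_contDiff_mul hV hG
  refine ⟨⟨h, hh⟩, mem_nonZeroDivisors_of_dense (by rwa [hsupp]), ⟨h * G, hhG⟩, fun e ↦ ?_⟩
  refine eq_of_eqOn_dense hVd fun x hx ↦ ?_
  change h x * (φ e).1 x = h x * G x * e.1.1 x
  rw [mul_assoc, hGe e x hx]

instance : IsReduced (Ck k) :=
  isReduced_of_injective (Ck k).subtype Subtype.val_injective

theorem exists_mul_eq_zero_sq_add_mem_nonZeroDivisors (a : Ck k) :
    ∃ b, a * b = 0 ∧ a ^ 2 + b ∈ (Ck k)⁰ := by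
  -- With `b` supported on the complement of the closure of the support of `a`, the two supports are
  -- disjoint and have dense union.
  obtain ⟨b, hb⟩ := exists_support_eq (k := k)
    (isClosed_closure (s := support a.1)).isOpen_compl
  have hab : ∀ x, a.1 x ≠ 0 → b.1 x = 0 := fun x hx ↦ by
    by_contra h
    have : x ∈ (closure (support a.1))ᶜ := hb ▸ h
    exact this (subset_closure hx)
  refine ⟨b, Subtype.ext <| funext fun x ↦ ?_, mem_nonZeroDivisors_of_dense ?_⟩
  · by_cases hx : a.1 x = 0
    · exact mul_eq_zero_of_left hx _
    · exact mul_eq_zero_of_right _ (hab x hx)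
  · have hsub : support a.1 ∪ support b.1 ⊆ support (a ^ 2 + b).1 := by
      rintro x hx
      change a.1 x ^ 2 + b.1 x ≠ 0
      by_cases hax : a.1 x = 0
      · simpa [hax] using hx
      · simpa [hab x hax] using hax
    refine Dense.mono hsub fun x ↦ ?_
    rw [closure_union]
    by_cases hx : x ∈ closure (support a.1)
    · exact .inl hx
    · exact .inr (subset_closure (hb ▸ hx))

end Ck

/-! ### The direct limit of the rings `C^k(V)` -/

namespace DenseOpensLimit

variable {k : ℕ∞}

theorem algebraMap_eq (V : DenseOpens) (a : Ck k) :
    algebraMap (Ck k) (DenseOpensLimit k) a = ⟦⟨V, algebraMap (Ck k) (CkOn k V.opens) a⟩⟧ :=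
  DirectLimit.algebraMap_def V a

/-- A non-zero-divisor has dense support and is invertible there; damping writes a function on a
dense open set as `(h * F) / h`. -/
instance : IsLocalization (Ck k)⁰ (DenseOpensLimit k) where
  map_units s := by
    let V : DenseOpens := OrderDual.toDual
      ⟨⟨support s.1.1, (Ck.continuous s.1).isOpen_support⟩,
        Ck.dense_support_of_mem_nonZeroDivisors s.2⟩
    let t : CkOn k V.opens := ⟨fun x ↦ (s.1.1 x)⁻¹, fun x ↦ (s.1.1 x)⁻¹,
      (Ck.contDiff s.1).contDiffOn.inv fun _ hx ↦ hx, fun _ ↦ rfl⟩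
    refine IsUnit.of_mul_eq_one (⟦⟨V, t⟩⟧ : DenseOpensLimit k) ?_
    rw [algebraMap_eq V, DirectLimit.mul_def, DirectLimit.one_def V]
    congr 2
    exact Subtype.ext <| funext fun x ↦ mul_inv_cancel₀ x.2
  surj z := by
    induction z using DirectLimit.induction with | _ V f
    obtain ⟨F, hF, hFf⟩ := f.2
    obtain ⟨h, hsupp, hh, hhF⟩ := exists_contDiff_support_eq_contDiff_mul V.opens.isOpen hF
    refine ⟨(⟨h * F, hhF⟩, ⟨⟨h, hh⟩, Ck.mem_nonZeroDivisors_of_dense ?_⟩), ?_⟩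
    · rw [hsupp]; exact (OrderDual.ofDual V).2
    · rw [algebraMap_eq V, algebraMap_eq V, DirectLimit.mul_def]
      congr 2
      refine Subtype.ext <| funext fun x ↦ ?_
      change f.1 x * h x = h x * F x
      rw [hFf, mul_comm]
  exists_of_eq {a b} hab := by
    let V : DenseOpens := OrderDual.toDual ⟨⊤, dense_univ⟩
    rw [algebraMap_eq V, algebraMap_eq V] at hab
    obtain ⟨W, _, _, h⟩ := Quotient.exact hab
    have : a = b := Ck.eq_of_eqOn_dense (OrderDual.ofDual W).2 fun x hx ↦
      congrFun (congrArg Subtype.val h) ⟨x, hx⟩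
    exact ⟨1, by rw [this]⟩

end DenseOpensLimit

end RingsOfQuotients

/-- `FractionRing (Ck k)`, the localization at all non-zero-divisors, is the classical ring of
quotients `Q_cl`. All isomorphisms are over `Ck k`. -/
theorem theorem3p3 (k : ℕ∞) :
    Nonempty (FractionRing (Ck k) ≃ₐ[Ck k] CompleteRingOfQuotients (Ck k)) ∧
    IsMaximalFlatEpiExtension (algebraMap (Ck k) (FractionRing (Ck k))) ∧
    IsSelfInjective (FractionRing (Ck k)) ∧
    IsVonNeumannRegular (FractionRing (Ck k)) ∧
    Nonempty (FractionRing (Ck k) ≃ₐ[Ck k] DenseOpensLimit k) := by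
  have h : HomsAreFractions (Ck k) := Ck.homsAreFractions
  have := h.isLocalization
  exact ⟨⟨IsLocalization.algEquiv (nonZeroDivisors (Ck k)) _ _⟩, h.isMaximalFlatEpiExtension,
    isSelfInjective_of_homsAreFractions h,
    isVonNeumannRegular_of_exists_add_mem_nonZeroDivisors (A := Ck k)
      Ck.exists_mul_eq_zero_sq_add_mem_nonZeroDivisors,
    ⟨IsLocalization.algEquiv (nonZeroDivisors (Ck k)) _ _⟩⟩
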